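/- Let $f(\xi)=\sum_{i,j,k,\ell=1}^3 C_{ijk\ell}\,\xi_{ij}\xi_{k\ell}$ be a real quadratic form in the entries of $\xi\in\mathbb R^{3\times 3}$, and suppose that $f$ is quasiconvex, i.e. $\int_\Omega f(\xi+\nabla\varphi(z))\,dz\ge|\Omega|\,f(\xi)$ for every bounded open set $\Omega\subset\mathbb R^3$, every $\xi\in\mathbb R^{3\times3}$ and every $\varphi\in C_c^\infty(\Omega;\mathbb R^3)$. For $y\in\mathbb R^3$ let $T(y)$ be the acoustic tensor of $f$, that is, the symmetric $3\times 3$ matrix with $f(x\otimes y)=x\,T(y)\,x^T$ for all $x\in\mathbb R^3$, where $(x\otimes y)_{ij}=x_iy_j$. Suppose that $\det T(y)=0$ for all $y\in\mathbb R^3$. Then at least one of the following holds: * $f$ is extremal: for every nonzero linear form $\ell$ on $\mathbb R^{3\times 3}$, the quadratic form $f-\ell^2$ is not quasiconvex; * $f$ is polyconvex: $f=g+N$, where $g$ is a convex quadratic form on $\mathbb R^{3\times3}$ and $N$ is a null-Lagrangian, i.e. a linear combination of the $2\times 2$ minors of $\xi$. -/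

import Mathlib

open MeasureTheory
open scoped ContDiff

/-- Real `3 × 3` matrices. -/
abbrev Mat3 : Type := Matrix (Fin 3) (Fin 3) ℝ

/-- Quadratic forms `f(ξ) = ∑ C_{ijkl} ξ_{ij} ξ_{kl}` in the nine entries of a `3 × 3` matrix. -/
abbrev Form3 : Type := QuadraticForm ℝ Mat3

/-- The gradient matrix `(∇φ(z))_{ij} = ∂φ_i/∂z_j` of a map `φ : ℝ³ → ℝ³`. -/
noncomputable def gradMatrix (φ : (Fin 3 → ℝ) → (Fin 3 → ℝ)) (z : Fin 3 → ℝ) : Mat3 :=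
  Matrix.of fun i j => fderiv ℝ φ z (Pi.single j 1) i

/-- Quasiconvexity in the sense of Morrey: on a bounded open set `Ω`, no smooth perturbation,
compactly supported in `Ω`, of an affine map of gradient `ξ` lowers the energy
`∫_Ω f(∇u(z)) dz` below its affine value `|Ω| f(ξ)`. -/
def IsQuasiconvex (f : Form3) : Prop :=
  ∀ Ω : Set (Fin 3 → ℝ), IsOpen Ω → Bornology.IsBounded Ω →
    ∀ (ξ : Mat3) (φ : (Fin 3 → ℝ) → (Fin 3 → ℝ)),
      ContDiff ℝ ∞ φ → HasCompactSupport φ → tsupport φ ⊆ Ω →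
        (volume Ω).toReal * f ξ ≤ ∫ z in Ω, f (ξ + gradMatrix φ z)

/-- The rank-one form `ξ ↦ ℓ(ξ)²` given by a linear form `ℓ`. -/
noncomputable def rankOneForm (l : Mat3 →ₗ[ℝ] ℝ) : Form3 :=
  QuadraticMap.linMulLin l l

/-- Extremality in the sense of Milton: `f` is quasiconvex, and subtracting any nonzero rank-one
form from `f` destroys quasiconvexity. -/
def IsExtremalForm (f : Form3) : Prop :=
  IsQuasiconvex f ∧ ∀ l : Mat3 →ₗ[ℝ] ℝ, l ≠ 0 → ¬ IsQuasiconvex (f - rankOneForm l)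

/-- Quadratic null-Lagrangians: the linear combinations of the nine `2 × 2` minors of `ξ`. The minor
with index `(i, j)` is obtained by deleting row `i` and column `j`. -/
def IsNullLagrangian (N : Form3) : Prop :=
  ∃ c : Fin 3 → Fin 3 → ℝ, ∀ ξ : Mat3,
    N ξ = ∑ i, ∑ j, c i j * (ξ.submatrix i.succAbove j.succAbove).det

/-- Polyconvexity of a quadratic form: it is a convex form plus a null-Lagrangian. -/
def IsPolyconvexForm (f : Form3) : Prop :=
  ∃ g N : Form3, ConvexOn ℝ Set.univ g ∧ IsNullLagrangian N ∧ f = g + N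

/-- The acoustic tensor (`y`-matrix) of `f`, with entries
`T(y)_{ik} = B(eᵢ ⊗ y, eₖ ⊗ y)`, where `B` is the symmetric bilinear form with `B(ξ, ξ) = f(ξ)`. -/
noncomputable def acousticTensor (f : Form3) (y : Fin 3 → ℝ) : Mat3 :=
  Matrix.of fun i k => QuadraticMap.associated (R := ℝ) f
    (Matrix.vecMulVec (Pi.single i 1) y) (Matrix.vecMulVec (Pi.single k 1) y)

/-- The acoustic tensor is the symmetric matrix with `f(x ⊗ y) = x T(y) xᵀ`. -/
theorem acousticTensor_spec (f : Form3) :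
    (∀ y, (acousticTensor f y).IsSymm) ∧
      ∀ x y, f (Matrix.vecMulVec x y) = x ⬝ᵥ (acousticTensor f y).mulVec x := by
  refine ⟨fun y => ?_, fun x y => ?_⟩
  · ext i k
    simp only [acousticTensor, Matrix.transpose_apply, Matrix.of_apply]
    exact QuadraticMap.associated_isSymm ℝ f _ _
  · have hx : Matrix.vecMulVec x y
        = ∑ i, x i • Matrix.vecMulVec (Pi.single i (1 : ℝ)) y := by
      ext a b
      simp [Matrix.sum_apply, Matrix.vecMulVec_apply, Pi.single_apply]
    rw [← QuadraticMap.associated_eq_self_apply ℝ f (Matrix.vecMulVec x y), hx]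
    simp only [map_sum, LinearMap.sum_apply, map_smul, LinearMap.smul_apply, smul_eq_mul,
      dotProduct, Matrix.mulVec, acousticTensor, Matrix.of_apply, Finset.mul_sum]
    rw [Finset.sum_comm]
    refine Finset.sum_congr rfl fun i _ => Finset.sum_congr rfl fun k _ => ?_
    ring

/-!
A quasiconvex quadratic form `f` is rank-one convex: `f(x ⊗ y) = x T(y) xᵀ ≥ 0`. Suppose that `f` is
not extremal, so that `f - l²` is still nonnegative on the rank-one matrices for some linear form
`l ≠ 0`. It is enough to write `f` on the rank-one matrices as a nonnegative quadratic form: the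
difference then vanishes on them, and polarization shows that such a form is a null-Lagrangian
(`isNullLagrangian_of_vanishes`).

By compactness there is a nonnegative form `g ≤ f - l²` (on rank-one matrices) whose Gram matrix has
maximal trace, and then `h = f - l² - g` dominates no square of a nonzero linear form
(`IsRankOneNonneg.exists_maximal`). Let `H(y)` be the acoustic tensor of `h`. Two facts drive the
proof that `h` vanishes on rank-one matrices.

* No `H(y)` has rank one: if `h(x ⊗ y₀) = a(x)²` with `a ≠ 0` linear, then the Cauchy-Schwarz
  inequality in `y` produces a square dominated by `h` (`DominatesNoSquare.eq_zero_of_eq_sq`).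
* Since `det T(y) = 0`, a kernel vector `v` of `T(y)` gives `h(v ⊗ y) = 0` and `l(v ⊗ y) = 0`, as
  `h`, `g` and `l²` are nonnegative there. If all `H(y)`, `y ≠ 0`, had rank exactly two, they would
  be bounded below on the complements of these kernels, uniformly on the unit sphere, and `h` would
  dominate a multiple of `l²` (`DominatesNoSquare.exists_forall_eq_zero`).

Hence `H(y₀) = 0` for some `y₀ ≠ 0`. The same argument with the roles of `x` and `y` exchanged gives
`x₀ ≠ 0` with `h(x₀ ⊗ y) = 0` for all `y`. What remains is a `2 × 2` biquadratic form; it has a zero,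
or else it would dominate a square, and the exclusion of rank one spreads this zero to all rank-one
matrices (`DominatesNoSquare.vanishes`).
-/

open Matrix (vecMulVec)

/-! ### Quadratic forms on `3 × 3` matrices -/

/-- The symmetric bilinear form `B` with `B(ξ, ξ) = f(ξ)`. -/
noncomputable abbrev polarForm (f : Form3) : LinearMap.BilinForm ℝ Mat3 :=
  QuadraticMap.associated (R := ℝ) f

/-- Rank-one convexity of a quadratic form: it is nonnegative on all matrices `x ⊗ y`. -/
def IsRankOneNonneg (f : Form3) : Prop :=
  ∀ x y : Fin 3 → ℝ, 0 ≤ f (vecMulVec x y)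

/-- No square of a nonzero linear form lies below `f` on the rank-one matrices. -/
def DominatesNoSquare (f : Form3) : Prop :=
  ∀ l : Mat3 →ₗ[ℝ] ℝ, (∀ x y : Fin 3 → ℝ, l (vecMulVec x y) ^ 2 ≤ f (vecMulVec x y)) → l = 0

/-- The form `ξ ↦ f(ξᵀ)`, which exchanges the two factors of a rank-one matrix. -/
noncomputable def transposeForm (f : Form3) : Form3 :=
  f.comp (Matrix.transposeLinearEquiv (Fin 3) (Fin 3) ℝ ℝ).toLinearMap

theorem transposeForm_vecMulVec (f : Form3) (x y : Fin 3 → ℝ) :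
    transposeForm f (vecMulVec x y) = f (vecMulVec y x) := by
  simp [transposeForm, Matrix.transpose_vecMulVec]

theorem IsRankOneNonneg.transpose {f : Form3} (hf : IsRankOneNonneg f) :
    IsRankOneNonneg (transposeForm f) := fun x y => by
  rw [transposeForm_vecMulVec]
  exact hf y x

theorem DominatesNoSquare.transpose {f : Form3} (hf : DominatesNoSquare f) :
    DominatesNoSquare (transposeForm f) := fun l hl => by
  have h := hf (l ∘ₗ (Matrix.transposeLinearEquiv (Fin 3) (Fin 3) ℝ ℝ).toLinearMap) fun x y => by
    have := hl y x
    rw [transposeForm_vecMulVec] at this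
    simpa [Matrix.transpose_vecMulVec] using this
  ext1 ξ
  simpa using LinearMap.congr_fun h ξ.transpose

theorem polarForm_self (f : Form3) (ξ : Mat3) : polarForm f ξ ξ = f ξ :=
  QuadraticMap.associated_eq_self_apply ℝ f ξ

theorem polarForm_comm (f : Form3) (ξ η : Mat3) : polarForm f ξ η = polarForm f η ξ :=
  QuadraticMap.associated_isSymm ℝ f ξ η

theorem form_add (f : Form3) (ξ η : Mat3) : f (ξ + η) = f ξ + f η + 2 * polarForm f ξ η := by
  rw [← polarForm_self, ← polarForm_self f ξ, ← polarForm_self f η]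
  simp only [map_add, LinearMap.add_apply]
  rw [polarForm_comm f η ξ]
  ring

theorem form_smul (f : Form3) (t : ℝ) (ξ : Mat3) : f (t • ξ) = t ^ 2 * f ξ := by
  rw [QuadraticMap.map_smul, smul_eq_mul, sq]

theorem matrix_eq_sum_single (ξ : Mat3) :
    ξ = ∑ i, ∑ j, ξ i j • vecMulVec (Pi.single i (1 : ℝ)) (Pi.single j (1 : ℝ)) := by
  ext a b
  fin_cases a <;> fin_cases b <;> simp [Fin.sum_univ_three, Matrix.vecMulVec_apply]

/-- The expansion `f(ξ) = ∑ C_{ijkl} ξ_{ij} ξ_{kl}`. -/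
theorem form_eq_sum (f : Form3) (ξ : Mat3) :
    f ξ = ∑ i, ∑ j, ∑ k, ∑ l, ξ i j * ξ k l *
      polarForm f (vecMulVec (Pi.single i 1) (Pi.single j 1))
        (vecMulVec (Pi.single k 1) (Pi.single l 1)) := by
  conv_lhs => rw [← polarForm_self, matrix_eq_sum_single ξ]
  simp only [map_sum, LinearMap.sum_apply, map_smul, LinearMap.smul_apply, smul_eq_mul,
    Finset.mul_sum, mul_assoc]
  refine Finset.sum_congr rfl fun i _ => Finset.sum_congr rfl fun j _ =>
    Finset.sum_congr rfl fun k _ => Finset.sum_congr rfl fun l _ => ?_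
  rw [polarForm_comm]

theorem continuous_form (f : Form3) : Continuous f := by
  have : (f : Mat3 → ℝ) = _ := funext (form_eq_sum f)
  rw [this]
  fun_prop

theorem continuous_linearForm (l : Mat3 →ₗ[ℝ] ℝ) : Continuous l :=
  l.continuous_of_finiteDimensional

/-! ### Polarization on rank-one matrices -/

/-- Cauchy-Schwarz for the form `y ↦ f(x ⊗ y)`. -/
theorem IsRankOneNonneg.polarForm_sq_le {f : Form3} (hf : IsRankOneNonneg f)
    (x y z : Fin 3 → ℝ) :
    polarForm f (vecMulVec x y) (vecMulVec x z) ^ 2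
      ≤ f (vecMulVec x y) * f (vecMulVec x z) := by
  have h (s t : ℝ) : 0 ≤ s ^ 2 * f (vecMulVec x y) + t ^ 2 * f (vecMulVec x z)
      + 2 * (s * t) * polarForm f (vecMulVec x y) (vecMulVec x z) := by
    have := hf x (s • y + t • z)
    rw [Matrix.vecMulVec_add, Matrix.vecMulVec_smul, Matrix.vecMulVec_smul, form_add, form_smul,
      form_smul, map_smul, LinearMap.map_smul₂, smul_eq_mul, smul_eq_mul] at this
    linarith
  have := discrim_le_zero (a := f (vecMulVec x y))
    (b := 2 * polarForm f (vecMulVec x y) (vecMulVec x z)) (c := f (vecMulVec x z))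
    fun s => by have := h s 1; linarith
  rw [discrim] at this
  linarith

/-- A bilinear function of `(x, y)` is a linear function of `x ⊗ y`. -/
theorem exists_linearForm_vecMulVec (b : (Fin 3 → ℝ) →ₗ[ℝ] (Fin 3 → ℝ) →ₗ[ℝ] ℝ) :
    ∃ l : Mat3 →ₗ[ℝ] ℝ, ∀ x y, l (vecMulVec x y) = b x y := by
  refine ⟨∑ i, ∑ j, b (Pi.single i 1) (Pi.single j 1) • Matrix.entryLinearMap ℝ ℝ i j,
    fun x y => ?_⟩
  have hx (x : Fin 3 → ℝ) : x = ∑ i, x i • Pi.single i (1 : ℝ) := by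
    ext a
    simp [Finset.sum_apply, Pi.single_apply]
  conv_rhs => rw [hx x, hx y]
  simp only [LinearMap.sum_apply, LinearMap.smul_apply, Matrix.entryLinearMap_apply,
    Matrix.vecMulVec_apply, map_sum, map_smul, smul_eq_mul, Finset.mul_sum]
  rw [Finset.sum_comm]
  refine Finset.sum_congr rfl fun i _ => Finset.sum_congr rfl fun j _ => by ring

/-- If `y ↦ f(x ⊗ y)` vanishes at `y₀`, then so does its polarization. -/
theorem IsRankOneNonneg.polarForm_eq_zero {f : Form3} (hf : IsRankOneNonneg f)
    {x y : Fin 3 → ℝ} (h : f (vecMulVec x y) = 0) (z : Fin 3 → ℝ) :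
    polarForm f (vecMulVec x y) (vecMulVec x z) = 0 := by
  have := hf.polarForm_sq_le x y z
  rw [h, zero_mul] at this
  exact pow_eq_zero_iff two_ne_zero |>.1 (le_antisymm this (sq_nonneg _))

theorem IsRankOneNonneg.polarForm_eq_zero_left {f : Form3} (hf : IsRankOneNonneg f)
    {x y : Fin 3 → ℝ} (h : f (vecMulVec x y) = 0) (z : Fin 3 → ℝ) :
    polarForm f (vecMulVec x y) (vecMulVec z y) = 0 := by
  have h1 := hf.transpose.polarForm_eq_zero (x := y) (y := x)
    (by rw [transposeForm_vecMulVec, h]) z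
  have h2 := form_add (transposeForm f) (vecMulVec y x) (vecMulVec y z)
  rw [h1, ← Matrix.vecMulVec_add] at h2
  simp only [transposeForm_vecMulVec] at h2
  rw [Matrix.add_vecMulVec, form_add] at h2
  linarith

/-! ### Exclusion of rank one -/

theorem nonneg_of_forall_ne_zero {c₀ c₁ c₂ : ℝ}
    (h : ∀ t : ℝ, t ≠ 0 → 0 ≤ c₀ + c₁ * t + c₂ * t ^ 2) : 0 ≤ c₀ := by
  have hc : Continuous fun t : ℝ => c₀ + c₁ * t + c₂ * t ^ 2 := by fun_prop
  have ht := (hc.tendsto 0).mono_left (nhdsWithin_le_nhds (s := {0}ᶜ))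
  have := ge_of_tendsto ht (Filter.eventually_of_mem self_mem_nhdsWithin h)
  simpa using this

/-- If `x ↦ f(x ⊗ y₀)` is the square of a linear form `a`, then `f` dominates the square of a linear
form `l` with `l(x ⊗ y₀) = a(x)`. The polarization `B(x ⊗ y₀, x ⊗ y)` is a quadratic form in `x`
that vanishes on the kernel of `a`, hence it equals `a(x) l(x ⊗ y)`, and the Cauchy-Schwarz
inequality gives `a(x)² l(x ⊗ y)² ≤ a(x)² f(x ⊗ y)`. -/
theorem DominatesNoSquare.eq_zero_of_eq_sq {f : Form3} (hf : IsRankOneNonneg f)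
    (hs : DominatesNoSquare f) {y₀ : Fin 3 → ℝ} {a : (Fin 3 → ℝ) →ₗ[ℝ] ℝ}
    (ha : ∀ x, f (vecMulVec x y₀) = a x ^ 2) : a = 0 := by
  by_contra hne
  obtain ⟨x₂, hx₂⟩ : ∃ x, a x ≠ 0 := by
    by_contra! h
    exact hne (LinearMap.ext h)
  obtain ⟨x₁, hx₁⟩ : ∃ x, a x = 1 := ⟨(a x₂)⁻¹ • x₂, by simp [hx₂]⟩
  let b : (Fin 3 → ℝ) →ₗ[ℝ] (Fin 3 → ℝ) →ₗ[ℝ] ℝ := LinearMap.mk₂ ℝ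
    (fun x y => polarForm f (vecMulVec x₁ y₀) (vecMulVec x y)
      + polarForm f (vecMulVec x y₀) (vecMulVec x₁ y)
      - a x * polarForm f (vecMulVec x₁ y₀) (vecMulVec x₁ y))
    (fun x x' y => by simp only [Matrix.add_vecMulVec, map_add, LinearMap.add_apply]; ring)
    (fun c x y => by
      simp only [Matrix.smul_vecMulVec, map_smul, LinearMap.smul_apply, smul_eq_mul]; ring)
    (fun x y y' => by simp only [Matrix.vecMulVec_add, map_add]; ring)
    (fun c x y => by simp only [Matrix.vecMulVec_smul, map_smul, smul_eq_mul]; ring)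
  have hb (x y) : b x y = polarForm f (vecMulVec x₁ y₀) (vecMulVec x y)
      + polarForm f (vecMulVec x y₀) (vecMulVec x₁ y)
      - a x * polarForm f (vecMulVec x₁ y₀) (vecMulVec x₁ y) := rfl
  obtain ⟨l, hl⟩ := exists_linearForm_vecMulVec b
  have key (x y) : polarForm f (vecMulVec x y₀) (vecMulVec x y) = a x * b x y := by
    obtain ⟨x', hx', hker⟩ : ∃ x', x = a x • x₁ + x' ∧ a x' = 0 :=
      ⟨x - a x • x₁, by simp, by simp [hx₁]⟩
    have h0 := hf.polarForm_eq_zero (x := x') (y := y₀) (by rw [ha, hker]; ring) y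
    rw [hb]
    generalize a x = α at *
    subst hx'
    simp only [Matrix.add_vecMulVec, Matrix.smul_vecMulVec, map_add, map_smul,
      LinearMap.add_apply, LinearMap.smul_apply, smul_eq_mul, h0]
    ring
  have hle (x y) (hax : a x ≠ 0) : b x y ^ 2 ≤ f (vecMulVec x y) := by
    have h1 := hf.polarForm_sq_le x y₀ y
    rw [key, ha, mul_pow] at h1
    exact le_of_mul_le_mul_left h1 (by positivity)
  have hl0 := hs l fun x y => by
    rw [hl]
    by_cases hax : a x = 0
    · refine sub_nonneg.1 (nonneg_of_forall_ne_zero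
        (c₁ := 2 * polarForm f (vecMulVec x y) (vecMulVec x₁ y) - 2 * b x y * b x₁ y)
        (c₂ := f (vecMulVec x₁ y) - b x₁ y ^ 2) fun t ht => ?_)
      have h1 := hle (x + t • x₁) y (by simpa [hax, hx₁] using ht)
      rw [Matrix.add_vecMulVec, Matrix.smul_vecMulVec, form_add, form_smul, map_smul, map_add,
        map_smul, LinearMap.add_apply, LinearMap.smul_apply, smul_eq_mul, smul_eq_mul] at h1
      linarith
    · exact hle x y hax
  have h1 := hl x₁ y₀
  rw [hl0, hb, hx₁, polarForm_self, ha, hx₁] at h1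
  norm_num at h1

theorem orthogonal_decomposition {u v : Fin 3 → ℝ} (hu : u ⬝ᵥ u = 1) (hv : v ⬝ᵥ v = 1)
    (huv : u ⬝ᵥ v = 0) (x : Fin 3 → ℝ) :
    x = (x ⬝ᵥ u) • u + (x ⬝ᵥ v) • v + (x ⬝ᵥ crossProduct u v) • crossProduct u v := by
  set n := crossProduct u v with hn
  have hun : u ⬝ᵥ n = 0 := dot_self_cross u v
  have hvn : v ⬝ᵥ n = 0 := dot_cross_self u v
  have hnn : n ⬝ᵥ n = 1 := by
    rw [hn, cross_dot_cross, hu, hv, huv, dotProduct_comm v u, huv]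
    norm_num
  have hM : Matrix.of ![u, v, n] * (Matrix.of ![u, v, n]).transpose = 1 := by
    ext i j
    change ![u, v, n] i ⬝ᵥ ![u, v, n] j = _
    fin_cases i <;> fin_cases j <;>
      simp [hu, hv, huv, hun, hvn, hnn, dotProduct_comm v u, dotProduct_comm n u,
        dotProduct_comm n v]
  rw [mul_eq_one_comm] at hM
  conv_lhs => rw [← Matrix.one_mulVec x, ← hM, ← Matrix.mulVec_mulVec]
  ext i
  simp only [Matrix.mulVec, dotProduct, Fin.sum_univ_three, Matrix.transpose_apply,
    Matrix.of_apply, Matrix.cons_val, Pi.add_apply, Pi.smul_apply, smul_eq_mul]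
  ring

/-- No acoustic tensor of a rank-one nonnegative form without dominated squares has rank one: if
`x ↦ f(x ⊗ y)` vanishes on a plane, then it vanishes identically. -/
theorem DominatesNoSquare.eq_zero_of_orthonormal {f : Form3} (hf : IsRankOneNonneg f)
    (hs : DominatesNoSquare f) {y u v : Fin 3 → ℝ} (hu : u ⬝ᵥ u = 1) (hv : v ⬝ᵥ v = 1)
    (huv : u ⬝ᵥ v = 0) (hfu : f (vecMulVec u y) = 0) (hfv : f (vecMulVec v y) = 0)
    (x : Fin 3 → ℝ) : f (vecMulVec x y) = 0 := by
  set n := crossProduct u v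
  have hx (x : Fin 3 → ℝ) : f (vecMulVec x y) = (x ⬝ᵥ n) ^ 2 * f (vecMulVec n y) := by
    conv_lhs => rw [orthogonal_decomposition hu hv huv x]
    simp only [Matrix.add_vecMulVec, Matrix.smul_vecMulVec, form_add, form_smul, map_add,
      map_smul, LinearMap.add_apply, LinearMap.smul_apply, smul_eq_mul, hf.polarForm_eq_zero_left hfu,
      hf.polarForm_eq_zero_left hfv, hfu, hfv]
    ring
  have ha := hs.eq_zero_of_eq_sq hf (y₀ := y)
    (a := √(f (vecMulVec n y)) • (dotProductBilin ℝ ℝ).flip n) fun x => by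
      rw [hx x]
      simp only [LinearMap.smul_apply, LinearMap.flip_apply, smul_eq_mul, mul_pow,
        Real.sq_sqrt (hf n y)]
      rw [mul_comm]; rfl
  have h := LinearMap.congr_fun ha x
  simp only [LinearMap.smul_apply, LinearMap.flip_apply, smul_eq_mul, LinearMap.zero_apply] at h
  rw [hx x, ← Real.sq_sqrt (hf n y), ← mul_pow, mul_comm]
  erw [h]
  norm_num

/-! ### Uniform positivity and vanishing of the remainder -/

theorem exists_unit_smul (x : Fin 3 → ℝ) : ∃ (c : ℝ) (u : Fin 3 → ℝ), u ⬝ᵥ u = 1 ∧ x = c • u := by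
  by_cases hx : x = 0
  · exact ⟨0, Pi.single 0 1, by simp, by simp [hx]⟩
  · have h : 0 < x ⬝ᵥ x := 
      (Finset.sum_nonneg fun i _ => mul_self_nonneg (x i)).lt_of_ne'
        fun h => hx (dotProduct_self_eq_zero.1 h)
    refine ⟨√(x ⬝ᵥ x), (√(x ⬝ᵥ x))⁻¹ • x, ?_, ?_⟩
    · rw [smul_dotProduct, dotProduct_smul, smul_eq_mul, smul_eq_mul, ← mul_assoc, ← mul_inv,
        Real.mul_self_sqrt h.le, inv_mul_cancel₀ h.ne']
    · rw [smul_smul, mul_inv_cancel₀ (Real.sqrt_pos.2 h).ne', one_smul]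

theorem exists_unit_orthogonal (v : Fin 3 → ℝ) : ∃ u : Fin 3 → ℝ, u ⬝ᵥ u = 1 ∧ u ⬝ᵥ v = 0 := by
  obtain ⟨w, hw, hwv⟩ : ∃ w : Fin 3 → ℝ, w ≠ 0 ∧ w ⬝ᵥ v = 0 := by
    by_cases h : v 0 = 0
    · exact ⟨Pi.single 0 1, by simp, by simp [h]⟩
    · refine ⟨![v 1, -v 0, 0], fun h0 => h ?_, ?_⟩
      · simpa using congr_fun h0 1
      · simp [dotProduct, Fin.sum_univ_three]
        ring
  obtain ⟨c, u, hu, rfl⟩ := exists_unit_smul w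
  refine ⟨u, hu, ?_⟩
  rw [smul_dotProduct, smul_eq_mul] at hwv
  exact (mul_eq_zero.1 hwv).resolve_left fun h => hw (by rw [h, zero_smul])

/-- Every vector is a multiple of `v`, or the sum of a multiple of `v` and a multiple of a unit
vector orthogonal to `v`. -/
theorem exists_orthogonal_decomposition {v : Fin 3 → ℝ} (hv : v ⬝ᵥ v = 1) (x : Fin 3 → ℝ) :
    ∃ (a c : ℝ) (u : Fin 3 → ℝ), u ⬝ᵥ u = 1 ∧ u ⬝ᵥ v = 0 ∧ x = a • v + c • u := by
  by_cases hx : x - (x ⬝ᵥ v) • v = 0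
  · obtain ⟨u, hu, huv⟩ := exists_unit_orthogonal v
    exact ⟨x ⬝ᵥ v, 0, u, hu, huv, by simpa [sub_eq_zero] using hx⟩
  · obtain ⟨c, u, hu, hxu⟩ := exists_unit_smul (x - (x ⬝ᵥ v) • v)
    refine ⟨x ⬝ᵥ v, c, u, hu, ?_, by rw [← hxu]; abel⟩
    have h : (x - (x ⬝ᵥ v) • v) ⬝ᵥ v = 0 := by
      rw [sub_dotProduct, smul_dotProduct, hv, smul_eq_mul]
      ring
    rw [hxu, smul_dotProduct, smul_eq_mul] at h
    exact (mul_eq_zero.1 h).resolve_left fun h => hx (by rw [hxu, h, zero_smul])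

theorem isCompact_unitVectors : IsCompact {x : Fin 3 → ℝ | x ⬝ᵥ x = 1} := by
  refine (isCompact_closedBall (0 : Fin 3 → ℝ) 1).of_isClosed_subset
    (isClosed_eq (by fun_prop) continuous_const) fun x hx => ?_
  rw [mem_closedBall_zero_iff, pi_norm_le_iff_of_nonneg zero_le_one]
  intro i
  have hx : ∑ j, x j * x j = 1 := hx
  rw [Real.norm_eq_abs, ← sq_le_one_iff_abs_le_one, sq, ← hx]
  exact Finset.single_le_sum (f := fun j => x j * x j) (fun j _ => mul_self_nonneg _)
    (Finset.mem_univ i)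

/-- A linear form `l` vanishes if, wherever `l(x ⊗ y) ≠ 0`, the pair `(x, y)` reduces up to scaling
to a compact set on which `f` is positive: otherwise `f` would dominate a multiple of `l²`. -/
theorem DominatesNoSquare.eq_zero_of_isCompact {f : Form3}
    (hs : DominatesNoSquare f) {l : Mat3 →ₗ[ℝ] ℝ} {K : Set ((Fin 3 → ℝ) × (Fin 3 → ℝ))}
    (hK : IsCompact K) (hpos : ∀ p ∈ K, 0 < f (vecMulVec p.1 p.2))
    (hred : ∀ x y, ∃ p ∈ K, ∃ s : ℝ, f (vecMulVec x y) = s ^ 2 * f (vecMulVec p.1 p.2) ∧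
      l (vecMulVec x y) = s * l (vecMulVec p.1 p.2)) : l = 0 := by
  have hv : Continuous fun p : (Fin 3 → ℝ) × (Fin 3 → ℝ) => vecMulVec p.1 p.2 :=
    continuous_fst.matrix_vecMulVec continuous_snd
  have hc : Continuous fun p : (Fin 3 → ℝ) × (Fin 3 → ℝ) =>
      f (vecMulVec p.1 p.2) / (1 + l (vecMulVec p.1 p.2) ^ 2) :=
    ((continuous_form f).comp hv).div
      (continuous_const.add (((continuous_linearForm l).comp hv).pow 2)) fun p => by
        have := sq_nonneg (l (vecMulVec p.1 p.2)); positivity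
  obtain ⟨δ, hδ, hle⟩ := hK.exists_forall_le' hc.continuousOn (a := 0) fun p hp => by
    have := hpos p hp; positivity
  have h0 := hs (√δ • l) fun x y => by
    obtain ⟨p, hp, s, hfs, hls⟩ := hred x y
    have h1 := hle p hp
    rw [le_div_iff₀ (by positivity)] at h1
    rw [LinearMap.smul_apply, smul_eq_mul, mul_pow, Real.sq_sqrt hδ.le, hls, hfs]
    nlinarith [mul_le_mul_of_nonneg_left h1 (sq_nonneg s), mul_nonneg (sq_nonneg s) hδ.le]
  exact (smul_eq_zero.1 h0).resolve_left (Real.sqrt_pos.2 hδ).ne'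

theorem IsRankOneNonneg.apply_smul_add {f : Form3} (hf : IsRankOneNonneg f)
    {v y : Fin 3 → ℝ} (h : f (vecMulVec v y) = 0) (a c : ℝ) (u : Fin 3 → ℝ) :
    f (vecMulVec (a • v + c • u) y) = c ^ 2 * f (vecMulVec u y) := by
  rw [Matrix.add_vecMulVec, Matrix.smul_vecMulVec, Matrix.smul_vecMulVec, form_add, form_smul,
    form_smul, map_smul, map_smul, LinearMap.smul_apply, hf.polarForm_eq_zero_left h, h]
  simp

/-- Let `T(y)` be the acoustic tensor of `f`, and suppose that every `T(y)` has a kernel vector `v`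
with `l(v ⊗ y) = 0`. If no `T(y)`, `y ≠ 0`, vanished, then all would have rank two, so that `T(y)`
would be uniformly positive on the orthogonal complement of its kernel, and `f` would dominate a
multiple of `l²`. -/
theorem DominatesNoSquare.exists_forall_eq_zero {f : Form3} (hf : IsRankOneNonneg f)
    (hs : DominatesNoSquare f) {l : Mat3 →ₗ[ℝ] ℝ} (hl : l ≠ 0)
    (hker : ∀ y : Fin 3 → ℝ, y ⬝ᵥ y = 1 →
      ∃ v : Fin 3 → ℝ, v ⬝ᵥ v = 1 ∧ f (vecMulVec v y) = 0 ∧ l (vecMulVec v y) = 0) :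
    ∃ y : Fin 3 → ℝ, y ⬝ᵥ y = 1 ∧ ∀ x, f (vecMulVec x y) = 0 := by
  by_contra! hne
  refine hl ?_
  let S : Set (Fin 3 → ℝ) := {x | x ⬝ᵥ x = 1}
  let K₀ : Set ((Fin 3 → ℝ) × (Fin 3 → ℝ) × (Fin 3 → ℝ)) :=
    (S ×ˢ S ×ˢ S) ∩ {q | q.1 ⬝ᵥ q.2.2 = 0 ∧ f (vecMulVec q.2.2 q.2.1) = 0}
  have hK₀ : IsCompact K₀ := by
    refine (isCompact_unitVectors.prod
      (isCompact_unitVectors.prod isCompact_unitVectors)).inter_right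
      (IsClosed.inter (isClosed_eq (by fun_prop) continuous_const) (isClosed_eq ?_ continuous_const))
    exact (continuous_form f).comp (Continuous.matrix_vecMulVec (by fun_prop) (by fun_prop))
  refine hs.eq_zero_of_isCompact
    (hK₀.image (f := fun q => (q.1, q.2.1)) (by fun_prop)) ?_ fun x y => ?_
  · rintro _ ⟨⟨x, y, v⟩, ⟨⟨hx, hy, hv⟩, hxv, hfv⟩, rfl⟩
    refine (hf x y).lt_of_ne' fun hfx => ?_
    obtain ⟨z, hz⟩ := hne y hy
    exact hz (hs.eq_zero_of_orthonormal hf hx hv hxv hfx hfv z)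
  · obtain ⟨d, w, hw, rfl⟩ := exists_unit_smul y
    obtain ⟨v, hv, hfv, hlv⟩ := hker w hw
    obtain ⟨a, c, u, hu, huv, rfl⟩ := exists_orthogonal_decomposition hv x
    refine ⟨(u, w), ⟨(u, w, v), ⟨⟨hu, hw, hv⟩, huv, hfv⟩, rfl⟩, d * c, ?_, ?_⟩
    · rw [Matrix.vecMulVec_smul, form_smul, hf.apply_smul_add hfv]
      ring
    · rw [Matrix.vecMulVec_smul, Matrix.add_vecMulVec, Matrix.smul_vecMulVec,
        Matrix.smul_vecMulVec, map_smul, map_add, map_smul, map_smul, hlv]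
      simp only [smul_eq_mul]
      ring

/-- The linear form with `x ⊗ y ↦ (a · x) (b · y)`. -/
theorem exists_linearForm_dotProduct (a b : Fin 3 → ℝ) :
    ∃ l : Mat3 →ₗ[ℝ] ℝ, ∀ x y, l (vecMulVec x y) = (x ⬝ᵥ a) * (y ⬝ᵥ b) :=
  exists_linearForm_vecMulVec (LinearMap.mk₂ ℝ (fun x y => (x ⬝ᵥ a) * (y ⬝ᵥ b))
    (fun x x' y => by rw [add_dotProduct]; ring)
    (fun c x y => by simp only [smul_dotProduct, smul_eq_mul]; ring)
    (fun x y y' => by rw [add_dotProduct]; ring)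
    (fun c x y => by simp only [smul_dotProduct, smul_eq_mul]; ring))

/-- If every acoustic tensor `T(y)` has a kernel vector `v` with `l(v ⊗ y) = 0`, for a linear form
`l ≠ 0`, and no square can be subtracted, then the form vanishes on rank-one matrices: first it does
not depend on one coordinate of `y`, then not on one coordinate of `x`, and a `2 × 2` biquadratic
form without dominated squares has a zero, which makes it vanish. -/
theorem DominatesNoSquare.vanishes {f : Form3} (hf : IsRankOneNonneg f)
    (hs : DominatesNoSquare f) {l : Mat3 →ₗ[ℝ] ℝ} (hl : l ≠ 0)
    (hker : ∀ y : Fin 3 → ℝ, y ⬝ᵥ y = 1 →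
      ∃ v : Fin 3 → ℝ, v ⬝ᵥ v = 1 ∧ f (vecMulVec v y) = 0 ∧ l (vecMulVec v y) = 0)
    (x y : Fin 3 → ℝ) : f (vecMulVec x y) = 0 := by
  obtain ⟨y₀, hy₀, hfy₀⟩ := hs.exists_forall_eq_zero hf hl hker
  obtain ⟨b, hb, hby₀⟩ := exists_unit_orthogonal y₀
  obtain ⟨x₀, hx₀, hfx₀⟩ : ∃ x₀ : Fin 3 → ℝ, x₀ ⬝ᵥ x₀ = 1 ∧ ∀ y, f (vecMulVec x₀ y) = 0 := by
    obtain ⟨m, hm⟩ := exists_linearForm_dotProduct b b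
    have hm0 : m ≠ 0 := by
      rintro rfl
      simpa [hb] using hm b b
    obtain ⟨x₀, hx₀, h⟩ := hs.transpose.exists_forall_eq_zero hf.transpose hm0 fun x _ =>
      ⟨y₀, hy₀, by rw [transposeForm_vecMulVec, hfy₀], by
        rw [hm, dotProduct_comm, hby₀, zero_mul]⟩
    exact ⟨x₀, hx₀, fun y => by rw [← transposeForm_vecMulVec, h]⟩
  obtain ⟨a, ha, hax₀⟩ := exists_unit_orthogonal x₀
  obtain ⟨x₁, y₁, hx₁, hy₁, hx₁₀, hy₁₀, hf₁⟩ : ∃ x₁ y₁ : Fin 3 → ℝ, x₁ ⬝ᵥ x₁ = 1 ∧ y₁ ⬝ᵥ y₁ = 1 ∧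
      x₁ ⬝ᵥ x₀ = 0 ∧ y₁ ⬝ᵥ y₀ = 0 ∧ f (vecMulVec x₁ y₁) = 0 := by
    by_contra! hne
    obtain ⟨m, hm⟩ := exists_linearForm_dotProduct a b
    have hm0 : m ≠ 0 := by
      rintro rfl
      simpa [ha, hb] using hm a b
    refine hm0 (hs.eq_zero_of_isCompact
      (K := ({x | x ⬝ᵥ x = 1} ∩ {x | x ⬝ᵥ x₀ = 0}) ×ˢ ({y | y ⬝ᵥ y = 1} ∩ {y | y ⬝ᵥ y₀ = 0}))
      ((isCompact_unitVectors.inter_right (isClosed_eq (by fun_prop) continuous_const)).prod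
        (isCompact_unitVectors.inter_right (isClosed_eq (by fun_prop) continuous_const))) ?_
      fun x y => ?_)
    · rintro ⟨x, y⟩ ⟨⟨hx, hx'⟩, hy, hy'⟩
      exact (hf x y).lt_of_ne' (hne x y hx hy hx' hy')
    · obtain ⟨α, c, u, hu, hux₀, rfl⟩ := exists_orthogonal_decomposition hx₀ x
      obtain ⟨β, d, w, hw, hwy₀, rfl⟩ := exists_orthogonal_decomposition hy₀ y
      refine ⟨(u, w), ⟨⟨hu, hux₀⟩, hw, hwy₀⟩, c * d, ?_, ?_⟩
      · rw [hf.apply_smul_add (hfx₀ _), ← transposeForm_vecMulVec,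
          hf.transpose.apply_smul_add (by rw [transposeForm_vecMulVec, hfy₀]),
          transposeForm_vecMulVec]
        ring
      · rw [hm, hm]
        simp only [add_dotProduct, smul_dotProduct, smul_eq_mul, dotProduct_comm x₀ a, hax₀,
          dotProduct_comm y₀ b, hby₀]
        ring
  have hx₁' (z) : f (vecMulVec x₁ z) = 0 := by
    rw [← transposeForm_vecMulVec]
    exact hs.transpose.eq_zero_of_orthonormal hf.transpose hy₁ hy₀ hy₁₀
      (by rw [transposeForm_vecMulVec, hf₁]) (by rw [transposeForm_vecMulVec, hfy₀]) z
  exact hs.eq_zero_of_orthonormal hf hx₁ hx₀ hx₁₀ (hx₁' y) (hfx₀ y) x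

/-! ### Null-Lagrangians and convex forms -/

/-- A form vanishing on rank-one matrices is a null-Lagrangian: polarization gives
`C_{ijil} = C_{ijkj} = 0` and `C_{ijkl} = -C_{ilkj}`. -/
theorem isNullLagrangian_of_vanishes {N : Form3} (hN : ∀ x y, N (vecMulVec x y) = 0) :
    IsNullLagrangian N := by
  have hpos : IsRankOneNonneg N := fun x y => (hN x y).ge
  let C (i j k l : Fin 3) : ℝ := polarForm N (vecMulVec (Pi.single i 1) (Pi.single j 1))
        (vecMulVec (Pi.single k 1) (Pi.single l 1))
  have hrow (i j l) : C i j i l = 0 := hpos.polarForm_eq_zero (hN _ _) _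
  have hcol (i j k) : C i j k j = 0 := hpos.polarForm_eq_zero_left (hN _ _) _
  have hsymm (i j k l) : C k l i j = C i j k l := polarForm_comm _ _ _
  have hswap (i j k l) : C i l k j = -C i j k l := by
    have h := hpos.polarForm_eq_zero (hN (Pi.single i 1 + Pi.single k 1) (Pi.single j 1))
      (Pi.single l 1)
    simp only [Matrix.add_vecMulVec, map_add, LinearMap.add_apply] at h
    have h1 : C i j i l + C k j i l + (C i j k l + C k j k l) = 0 := h
    rw [hrow, hrow, ← hsymm] at h1
    linarith
  refine ⟨fun i j => 2 * C (i.succAbove 0) (j.succAbove 0) (i.succAbove 1) (j.succAbove 1),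
    fun ξ => ?_⟩
  rw [form_eq_sum]
  change ∑ i, ∑ j, ∑ k, ∑ l, ξ i j * ξ k l * C i j k l = _
  -- rewriting rules that reduce the 81 coefficients to the nine with `i < k` and `j < l`
  have h01 (j l) : C 1 j 0 l = C 0 l 1 j := (hsymm _ _ _ _).symm
  have h02 (j l) : C 2 j 0 l = C 0 l 2 j := (hsymm _ _ _ _).symm
  have h12 (j l) : C 2 j 1 l = C 1 l 2 j := (hsymm _ _ _ _).symm
  have s01 (i k) : C i 1 k 0 = -C i 0 k 1 := hswap _ _ _ _
  have s02 (i k) : C i 2 k 0 = -C i 0 k 2 := hswap _ _ _ _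
  have s12 (i k) : C i 2 k 1 = -C i 1 k 2 := hswap _ _ _ _
  have e00 : (0 : Fin 3).succAbove (0 : Fin 2) = 1 := rfl
  have e01 : (0 : Fin 3).succAbove (1 : Fin 2) = 2 := rfl
  have e10 : (1 : Fin 3).succAbove (0 : Fin 2) = 0 := rfl
  have e11 : (1 : Fin 3).succAbove (1 : Fin 2) = 2 := rfl
  have e20 : (2 : Fin 3).succAbove (0 : Fin 2) = 0 := rfl
  have e21 : (2 : Fin 3).succAbove (1 : Fin 2) = 1 := rfl
  simp only [Fin.sum_univ_three, Matrix.det_fin_two, Matrix.submatrix_apply, e00, e01, e10, e11,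
    e20, e21, h01, h02, h12, hrow, hcol, s01, s02, s12]
  ring

theorem convexOn_of_nonneg {g : Form3} (hg : ∀ ξ, 0 ≤ g ξ) : ConvexOn ℝ Set.univ g := by
  refine ⟨convex_univ, fun ξ _ η _ a b ha hb hab => ?_⟩
  have h1 := mul_nonneg (mul_nonneg ha hb) (hg (ξ + (-1 : ℝ) • η))
  rw [form_add, form_smul, map_smul] at h1
  rw [form_add, form_smul, form_smul, map_smul, map_smul, LinearMap.smul_apply]
  simp only [smul_eq_mul] at h1 ⊢
  obtain rfl : b = 1 - a := by linarith
  nlinarith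

/-! ### Maximal convex forms below a given form -/

/-- The quadratic form on `Mat3` with Gram matrix `Q`. -/
noncomputable def gramForm (Q : Matrix (Fin 3 × Fin 3) (Fin 3 × Fin 3) ℝ) : Form3 :=
  ∑ a, ∑ b, Q a b • QuadraticMap.linMulLin
    (Matrix.entryLinearMap ℝ ℝ a.1 a.2) (Matrix.entryLinearMap ℝ ℝ b.1 b.2)

theorem gramForm_apply (Q : Matrix (Fin 3 × Fin 3) (Fin 3 × Fin 3) ℝ) (ξ : Mat3) :
    gramForm Q ξ = ∑ a, ∑ b, Q a b * (ξ a.1 a.2 * ξ b.1 b.2) := by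
  simp [gramForm]

theorem gramForm_add (P Q : Matrix (Fin 3 × Fin 3) (Fin 3 × Fin 3) ℝ) :
    gramForm (P + Q) = gramForm P + gramForm Q := by
  simp [gramForm, add_smul, Finset.sum_add_distrib]

/-- The coefficient vector of a linear form on `Mat3`. -/
noncomputable def linearFormCoeff (l : Mat3 →ₗ[ℝ] ℝ) (a : Fin 3 × Fin 3) : ℝ :=
  l (vecMulVec (Pi.single a.1 1) (Pi.single a.2 1))

theorem linearForm_eq_sum (l : Mat3 →ₗ[ℝ] ℝ) (ξ : Mat3) :
    l ξ = ∑ a : Fin 3 × Fin 3, linearFormCoeff l a * ξ a.1 a.2 := by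
  conv_lhs => rw [matrix_eq_sum_single ξ]
  rw [Fintype.sum_prod_type]
  simp only [map_sum, map_smul, smul_eq_mul, linearFormCoeff, mul_comm]

theorem gramForm_vecMulVec_linearFormCoeff (l : Mat3 →ₗ[ℝ] ℝ) (ξ : Mat3) :
    gramForm (vecMulVec (linearFormCoeff l) (linearFormCoeff l)) ξ = l ξ ^ 2 := by
  rw [gramForm_apply, linearForm_eq_sum, sq, Finset.sum_mul_sum]
  simp only [Matrix.vecMulVec_apply]
  exact Finset.sum_congr rfl fun a _ => Finset.sum_congr rfl fun b _ => by ring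


/-- The Gram matrices of the convex forms lying below `f` on the rank-one matrices. -/
def subordinateGram (f : Form3) : Set (Matrix (Fin 3 × Fin 3) (Fin 3 × Fin 3) ℝ) :=
  {Q | Q.PosSemidef ∧ ∀ x y, gramForm Q (vecMulVec x y) ≤ f (vecMulVec x y)}

theorem gramForm_eq_dotProduct (Q : Matrix (Fin 3 × Fin 3) (Fin 3 × Fin 3) ℝ) (ξ : Mat3) :
    gramForm Q ξ = (fun a : Fin 3 × Fin 3 => ξ a.1 a.2) ⬝ᵥ
      Q.mulVec (fun a : Fin 3 × Fin 3 => ξ a.1 a.2) := by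
  rw [gramForm_apply]
  simp only [dotProduct, Matrix.mulVec, Finset.mul_sum]
  exact Finset.sum_congr rfl fun a _ => Finset.sum_congr rfl fun b _ => by ring

theorem gramForm_nonneg {Q : Matrix (Fin 3 × Fin 3) (Fin 3 × Fin 3) ℝ} (hQ : Q.PosSemidef)
    (ξ : Mat3) : 0 ≤ gramForm Q ξ := by
  rw [gramForm_eq_dotProduct]
  simpa using hQ.dotProduct_mulVec_nonneg (fun a : Fin 3 × Fin 3 => ξ a.1 a.2)

theorem gramForm_single (Q : Matrix (Fin 3 × Fin 3) (Fin 3 × Fin 3) ℝ) (a : Fin 3 × Fin 3) :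
    gramForm Q (vecMulVec (Pi.single a.1 1) (Pi.single a.2 1)) = Q a a := by
  have h : (fun c : Fin 3 × Fin 3 => vecMulVec (Pi.single a.1 (1 : ℝ)) (Pi.single a.2 1) c.1 c.2)
      = Pi.single a 1 := by
    ext c
    simp [Matrix.vecMulVec_apply, Pi.single_apply, Prod.ext_iff, ← ite_and, and_comm]
  rw [gramForm_eq_dotProduct, h]
  simp

theorem abs_apply_le_of_posSemidef {n : Type*} [Fintype n] [DecidableEq n] {Q : Matrix n n ℝ}
    (hQ : Q.PosSemidef) {M : ℝ} (hM : ∀ a, Q a a ≤ M) (a b : n) : |Q a b| ≤ M := by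
  have hab (s : ℝ) : 0 ≤ Q a a + s * Q b a + s * (Q a b + s * Q b b) := by
    have h := hQ.dotProduct_mulVec_nonneg (Pi.single a 1 + s • Pi.single b 1)
    rw [star_trivial, Matrix.mulVec_add, Matrix.mulVec_smul] at h
    simp only [add_dotProduct, dotProduct_add, smul_dotProduct, dotProduct_smul,
      Matrix.mulVec_single_one, single_one_dotProduct, Matrix.col_apply, smul_eq_mul] at h
    linarith
  have hsymm : Q b a = Q a b := by simpa using hQ.1.apply a b
  have h1 := hab 1
  have h2 := hab (-1)
  have ha := hM a
  have hb := hM b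
  exact abs_le.2 ⟨by linarith, by linarith⟩

theorem isCompact_subordinateGram (f : Form3) : IsCompact (subordinateGram f) := by
  let M : ℝ := ∑ a : Fin 3 × Fin 3, |f (vecMulVec (Pi.single a.1 1) (Pi.single a.2 1))|
  have hK : IsCompact (Set.univ.pi fun _ => Set.univ.pi fun _ => Set.Icc (-M) M :
      Set (Matrix (Fin 3 × Fin 3) (Fin 3 × Fin 3) ℝ)) :=
    isCompact_univ_pi fun _ => isCompact_univ_pi fun _ => isCompact_Icc
  refine hK.of_isClosed_subset ?_ fun Q hQ => ?_
  · have hc (ξ : Mat3) : Continuous fun Q => gramForm Q ξ := by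
      simp only [gramForm_apply]
      fun_prop
    have : subordinateGram f = {Q | Q.transpose = Q} ∩
        (⋂ v : Fin 3 × Fin 3 → ℝ, {Q | 0 ≤ v ⬝ᵥ Q.mulVec v}) ∩
        ⋂ x, ⋂ y, {Q | gramForm Q (vecMulVec x y) ≤ f (vecMulVec x y)} := by
      ext Q
      simp [subordinateGram, Matrix.posSemidef_iff_dotProduct_mulVec, Matrix.IsHermitian]
    rw [this]
    refine IsClosed.inter (IsClosed.inter ?_ ?_) ?_
    · exact isClosed_eq continuous_id.matrix_transpose continuous_id
    · exact isClosed_iInter fun v => isClosed_le continuous_const (by fun_prop)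
    · exact isClosed_iInter fun x => isClosed_iInter fun y => isClosed_le (hc _) continuous_const
  · have hd (a) : Q a a ≤ M := by
      rw [← gramForm_single Q a]
      exact (hQ.2 _ _).trans ((le_abs_self _).trans (Finset.single_le_sum
        (f := fun a : Fin 3 × Fin 3 => |f (vecMulVec (Pi.single a.1 1) (Pi.single a.2 1))|)
        (fun _ _ => abs_nonneg _) (Finset.mem_univ a)))
    exact fun a _ b _ => abs_le.1 (abs_apply_le_of_posSemidef hQ.1 hd a b)

/-- Removing a convex form of maximal trace leaves a form without dominated squares. -/
theorem IsRankOneNonneg.exists_maximal {f : Form3} (hf : IsRankOneNonneg f) :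
    ∃ g : Form3, (∀ ξ, 0 ≤ g ξ) ∧ IsRankOneNonneg (f - g) ∧ DominatesNoSquare (f - g) := by
  obtain ⟨Q, hQ, hmax⟩ := (isCompact_subordinateGram f).exists_isMaxOn
    ⟨0, Matrix.PosSemidef.zero, fun x y => by simpa [gramForm] using hf x y⟩
    (f := Matrix.trace) (continuous_id.matrix_trace.continuousOn)
  refine ⟨gramForm Q, gramForm_nonneg hQ.1, fun x y => ?_, fun l hl => ?_⟩
  · simpa using hQ.2 x y
  · have hmem : Q + vecMulVec (linearFormCoeff l) (linearFormCoeff l) ∈ subordinateGram f := by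
      refine ⟨hQ.1.add (by simpa using
        Matrix.posSemidef_vecMulVec_self_star (linearFormCoeff l)), fun x y => ?_⟩
      have := hl x y
      rw [sub_apply] at this
      rw [gramForm_add, add_apply, gramForm_vecMulVec_linearFormCoeff]
      linarith
    have h : (Q + vecMulVec (linearFormCoeff l) (linearFormCoeff l)).trace ≤ Q.trace := hmax hmem
    rw [Matrix.trace_add, Matrix.trace_vecMulVec] at h
    have h0 : linearFormCoeff l = 0 := dotProduct_self_eq_zero.1
      (le_antisymm (by linarith) (Finset.sum_nonneg fun i _ => mul_self_nonneg _))
    ext1 ξ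
    simp [linearForm_eq_sum, h0]

/-! ### Quasiconvexity implies rank-one convexity -/

theorem gradMatrix_smul_const {ψ : (Fin 3 → ℝ) → ℝ} (hψ : Differentiable ℝ ψ) (x z : Fin 3 → ℝ) :
    gradMatrix (fun z => ψ z • x) z = vecMulVec x fun j => fderiv ℝ ψ z (Pi.single j 1) := by
  ext i j
  rw [gradMatrix, Matrix.of_apply, fderiv_smul_const (hψ z), Matrix.vecMulVec_apply]
  simp [mul_comm]

/-- Testing quasiconvexity at `ξ = 0` with `φ = ψ x`. -/
theorem IsQuasiconvex.integral_nonneg {f : Form3} (hf : IsQuasiconvex f) (x : Fin 3 → ℝ)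
    {ψ : (Fin 3 → ℝ) → ℝ} (hψ : ContDiff ℝ ∞ ψ) (hc : HasCompactSupport ψ) {r : ℝ}
    (hr : tsupport ψ ⊆ Metric.ball 0 r) :
    0 ≤ ∫ z in Metric.ball (0 : Fin 3 → ℝ) r,
      f (vecMulVec x fun j => fderiv ℝ ψ z (Pi.single j 1)) := by
  have hs : tsupport (fun z => ψ z • x) ⊆ tsupport ψ := tsupport_smul_subset_left ψ fun _ => x
  have h := hf (Metric.ball 0 r) Metric.isOpen_ball Metric.isBounded_ball 0 (fun z => ψ z • x)
    (hψ.smul contDiff_const) (hc.smul_right (f' := fun _ => x)) (hs.trans hr)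
  simpa only [map_zero, mul_zero, zero_add,
    gradMatrix_smul_const (hψ.differentiable (by simp))] using h

/-- Quasiconvex forms are rank-one convex. With a bump function `η`, the two test functions
`η sin(n y · z)` and `η cos(n y · z)` have gradient energies with sum
`f(x ⊗ ∇η) + n² η² f(x ⊗ y)`; the last term dominates for large `n`. -/
theorem IsQuasiconvex.isRankOneNonneg {f : Form3} (hf : IsQuasiconvex f) :
    IsRankOneNonneg f := by
  intro x y
  let η : ContDiffBump (0 : Fin 3 → ℝ) := ⟨1, 2, one_pos, one_lt_two⟩
  have hη : ContDiff ℝ ∞ η := η.contDiff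
  have hηs : tsupport η ⊆ Metric.ball 0 3 := by
    rw [η.tsupport_eq]
    exact Metric.closedBall_subset_ball (by norm_num [η])
  let p : (Fin 3 → ℝ) →L[ℝ] ℝ := LinearMap.toContinuousLinearMap ((dotProductBilin ℝ ℝ) y)
  have hp (j) : p (Pi.single j 1) = y j := by
    change y ⬝ᵥ Pi.single j 1 = y j
    simp
  let D (z : Fin 3 → ℝ) : Fin 3 → ℝ := fun j => fderiv ℝ η z (Pi.single j 1)
  have hDc : Continuous D :=
    continuous_pi fun j => (hη.continuous_fderiv (by simp)).clm_apply continuous_const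
  have hv : Continuous fun u : Fin 3 → ℝ => vecMulVec x u :=
    continuous_const.matrix_vecMulVec continuous_id
  have hi {g : (Fin 3 → ℝ) → ℝ} (hg : Continuous g) : IntegrableOn g (Metric.ball 0 3) :=
    (hg.locallyIntegrable.integrableOn_isCompact (isCompact_closedBall 0 3)).mono_set
      Metric.ball_subset_closedBall
  set I := ∫ z in Metric.ball (0 : Fin 3 → ℝ) 3, f (vecMulVec x (D z))
  set J := ∫ z in Metric.ball (0 : Fin 3 → ℝ) 3, η z ^ 2 with hJ
  have hJpos : 0 < J := by
    rw [hJ, setIntegral_eq_integral_of_forall_compl_eq_zero fun z hz => by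
      rw [image_eq_zero_of_notMem_tsupport fun h => hz (hηs h), sq, zero_mul]]
    refine (η.continuous.pow 2).integral_pos_of_hasCompactSupport_nonneg_nonzero
      (η.hasCompactSupport.comp_left (g := fun t : ℝ => t ^ 2) (by simp)) (fun z => sq_nonneg _)
      (x := 0) ?_
    rw [η.one_of_mem_closedBall (by simp [η.rIn_pos.le])]
    norm_num
  have key (n : ℝ) : 0 ≤ I + n ^ 2 * f (vecMulVec x y) * J := by
    have test (s c : ℝ → ℝ) (hs : ContDiff ℝ ∞ s) (hsc : ∀ t, HasDerivAt s (c t) t) :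
        0 ≤ ∫ z in Metric.ball (0 : Fin 3 → ℝ) 3,
          f (vecMulVec x (s (n * p z) • D z + (n * η z * c (n * p z)) • y)) := by
      have hψ : ContDiff ℝ ∞ fun z => s (n * p z) * η z :=
        (hs.comp (contDiff_const.mul p.contDiff)).mul hη
      have h := hf.integral_nonneg x hψ η.hasCompactSupport.mul_left
        ((tsupport_mul_subset_right).trans hηs)
      convert h using 6 with z j
      have hd : HasFDerivAt (fun z => s (n * p z) * η z) _ z :=
        ((hsc (n * p z)).comp_hasFDerivAt z (p.hasFDerivAt.const_mul n)).mul
          (hη.differentiable (by simp) z).hasFDerivAt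
      rw [hd.fderiv]
      simp [D, hp]
      ring
    have hs := test Real.sin Real.cos Real.contDiff_sin Real.hasDerivAt_sin
    have hc := test Real.cos (fun t => -Real.sin t) Real.contDiff_cos Real.hasDerivAt_cos
    have hint {s c : ℝ → ℝ} (hs : Continuous s) (hc : Continuous c) :
        IntegrableOn (fun z => f (vecMulVec x (s (n * p z) • D z + (n * η z * c (n * p z)) • y)))
          (Metric.ball 0 3) :=
      hi ((continuous_form f).comp (hv.comp (by fun_prop)))
    have hsum := add_nonneg hs hc
    rw [← integral_add (hint Real.continuous_sin Real.continuous_cos)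
      (hint (c := fun t => -Real.sin t) Real.continuous_cos Real.continuous_sin.neg)] at hsum
    have hIJ : I + n ^ 2 * f (vecMulVec x y) * J = ∫ z in Metric.ball (0 : Fin 3 → ℝ) 3,
        (f (vecMulVec x (D z)) + n ^ 2 * f (vecMulVec x y) * η z ^ 2) := by
      have h1 : IntegrableOn (fun z => f (vecMulVec x (D z))) (Metric.ball 0 3) :=
        hi ((continuous_form f).comp (hv.comp hDc))
      have h2 : IntegrableOn (fun z => n ^ 2 * f (vecMulVec x y) * η z ^ 2) (Metric.ball 0 3) :=
        hi (continuous_const.mul (η.continuous.pow 2))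
      rw [integral_add h1 h2, integral_const_mul]
    rw [hIJ]
    refine hsum.trans_eq (integral_congr_ae (.of_forall fun z => ?_))
    -- the cross terms of the two energies cancel
    simp only [Matrix.vecMulVec_add, Matrix.vecMulVec_smul, form_add, form_smul, map_smul,
      LinearMap.smul_apply, smul_eq_mul]
    linear_combination (f (vecMulVec x (D z)) + n ^ 2 * f (vecMulVec x y) * η z ^ 2)
      * Real.sin_sq_add_cos_sq (n * p z)
  by_contra! hneg
  have hn := key (√((|I| + 1) / (-f (vecMulVec x y) * J)))
  have hd : 0 < -f (vecMulVec x y) * J := mul_pos (by linarith) hJpos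
  rw [Real.sq_sqrt (by positivity)] at hn
  have h1 : (|I| + 1) / (-f (vecMulVec x y) * J) * f (vecMulVec x y) * J = -(|I| + 1) := by
    have := hneg.ne
    field_simp
  have := le_abs_self I
  linarith

/-! ### Forms with singular acoustic tensor -/

theorem exists_unit_zero_of_det_acousticTensor {f : Form3} {y : Fin 3 → ℝ}
    (h : (acousticTensor f y).det = 0) :
    ∃ v : Fin 3 → ℝ, v ⬝ᵥ v = 1 ∧ f (vecMulVec v y) = 0 := by
  obtain ⟨x, hx, hTx⟩ := Matrix.exists_mulVec_eq_zero_iff.2 h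
  have hfx : f (vecMulVec x y) = 0 := by
    rw [(acousticTensor_spec f).2, hTx, dotProduct_zero]
  obtain ⟨c, v, hv, rfl⟩ := exists_unit_smul x
  refine ⟨v, hv, ?_⟩
  rw [Matrix.smul_vecMulVec, form_smul] at hfx
  exact (mul_eq_zero.1 hfx).resolve_left (pow_ne_zero 2 fun hc => hx (by rw [hc, zero_smul]))

theorem theorem3p6 (f : QuadraticForm ℝ (Matrix (Fin 3) (Fin 3) ℝ)) (hf : IsQuasiconvex f)
    (hdet : ∀ y : Fin 3 → ℝ, (acousticTensor f y).det = 0) :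
    IsExtremalForm f ∨ IsPolyconvexForm f := by
  refine or_iff_not_imp_left.2 fun hne => ?_
  obtain ⟨l, hl, hq⟩ : ∃ l : Mat3 →ₗ[ℝ] ℝ, l ≠ 0 ∧ IsQuasiconvex (f - rankOneForm l) := by
    by_contra! h
    exact hne ⟨hf, h⟩
  have happ (ξ : Mat3) : rankOneForm l ξ = l ξ ^ 2 := by
    rw [rankOneForm, QuadraticMap.linMulLin_apply, sq]
  obtain ⟨g, hg, hpos, hs⟩ := hq.isRankOneNonneg.exists_maximal
  have hvan := hs.vanishes hpos hl fun y _ => by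
    obtain ⟨v, hv, hfv⟩ := exists_unit_zero_of_det_acousticTensor (hdet y)
    -- `0 = f = (f - l² - g) + g + l²` at `v ⊗ y`, with nonnegative summands
    have h1 := hpos v y
    have h2 := hg (vecMulVec v y)
    have h3 := sq_nonneg (l (vecMulVec v y))
    simp only [sub_apply, happ, hfv] at h1 ⊢
    exact ⟨v, hv, by linarith, pow_eq_zero_iff two_ne_zero |>.1 (by linarith)⟩
  exact ⟨g + rankOneForm l, f - rankOneForm l - g,
    convexOn_of_nonneg fun ξ => by
      rw [add_apply, happ]
      exact add_nonneg (hg ξ) (sq_nonneg _),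
    isNullLagrangian_of_vanishes hvan, by abel⟩
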